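/- All quantum systems are finite-dimensional Hilbert spaces, $\mathfrak S(X)$ is the set of density matrices of $X$, and $\mathrm{Ad}_U(M)=UMU^\dagger$. A unitary $U$ on $A\otimes B$ is *compatible* with $\sigma_B\in\mathfrak S(B)$ if $\mathrm{Tr}_A\,\mathrm{Ad}_U(\rho\otimes\sigma_B)=\sigma_B$ for all $\rho\in\mathfrak S(A)$. A pair of unitaries $(U_0,U_1)$, on $A_0\otimes B_0$ and $A_1\otimes B_1$, is compatible with $\sigma_{B_0B_1}\in\mathfrak S(B_0\otimes B_1)$ if $\mathrm{Tr}_{A_0A_1}\mathrm{Ad}_{U_0\otimes U_1}(\rho\otimes\sigma_{B_0B_1})=\sigma_{B_0B_1}$ for all $\rho\in\mathfrak S(A_0\otimes A_1)$. A unitary $U_0$ on $A_0\otimes B_0$ *utilizes information* of $\sigma_{B_0}$ if the channel $\rho\mapsto\mathrm{Tr}_{B_0}\mathrm{Ad}_{U_0}(\rho\otimes\sigma_{B_0})$ on $A_0$ is not a unitary channel $\rho\mapsto V\rho V^\dagger$. **Theorem.** (a) Let $U_0$ be a unitary on $A_0\otimes B_0$ that is compatible with $\sigma_{B_0}\in\mathfrak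 S(B_0)$ and utilizes information of $\sigma_{B_0}$. Then there is a system $B_1$ and an extension $\sigma_{B_0B_1}\in\mathfrak S(B_0\otimes B_1)$ of $\sigma_{B_0}$ (that is, $\mathrm{Tr}_{B_1}\sigma_{B_0B_1}=\sigma_{B_0}$), which is moreover pure (a purification of $\sigma_{B_0}$), such that for every nonzero system $A_1$ and every unitary $U_1$ on $A_1\otimes B_1$ the pair $(U_0,U_1)$ is not compatible with $\sigma_{B_0B_1}$. Thus no quantum information is universally nonphysical. (b) In contrast, this fails for classical information. Let $X,Y$ be finite sets, and call a permutation $f=(f_1,f_2)$ of $X\times Y$ compatible with a probability vector $p$ on $Y$ if $\sum_{j':\,f_2(i,j')=j}p_{j'}=p_j$ for all $i\in X$, $j\in Y$. If $f$ only reads $Y$, i.e. $f_2(i,j)=j$ for all $i,j$, then for every finite set $Z$ and every probability vector $q$ on $Y\times Z$ with $Y$-marginal $p$, the permutation $f\times\mathrm{id}_Z$ of $X\times(Y\times Z)$ is compatible with $q$. Moreover, if $|X|\ge 2$ and $p$ is not a point mass, there is such a reading permutation $f$ that utilizes information of $p$: there is no permutation $g$ of $X$ with $f_1(i,j)=g(i)$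 for all $i$ and all $j$ with $p_j\neq 0$. -/

import Mathlib

universe u v w

open Matrix
open scoped Kronecker ComplexOrder

/-! A finite-dimensional quantum system is given by the finite index type of an orthonormal basis,
its operators are complex matrices over that type, and a composite system is given by the product
of the index types. -/

/-- Density matrices: positive semidefinite with unit trace. -/
def IsState {X : Type*} [Fintype X] (ρ : Matrix X X ℂ) : Prop :=
  ρ.PosSemidef ∧ ρ.trace = 1

/-- The state is pure: it is `|ψ⟩⟨ψ|` for some vector `ψ`. -/
def IsPureState {X : Type*} [Fintype X] (ρ : Matrix X X ℂ) : Prop :=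
  IsState ρ ∧ ∃ ψ : X → ℂ, ρ = vecMulVec ψ (star ψ)

/-- Partial trace over the first factor. -/
def traceFst {A B : Type*} [Fintype A] (M : Matrix (A × B) (A × B) ℂ) : Matrix B B ℂ :=
  Matrix.of fun j j' => ∑ i, M (i, j) (i, j')

/-- Partial trace over the second factor. -/
def traceSnd {A B : Type*} [Fintype B] (M : Matrix (A × B) (A × B) ℂ) : Matrix A A ℂ :=
  Matrix.of fun i i' => ∑ j, M (i, j) (i', j)

/-- `Ad_U (M) = U M U†`. -/
def Ad {X : Type*} [Fintype X] (U M : Matrix X X ℂ) : Matrix X X ℂ :=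
  U * M * Uᴴ

/-- `U` (on `A ⊗ B`) is compatible with the catalyst `σ` (on `B`): the catalyst is returned
unchanged, whatever the input state of `A` is. -/
def IsCompatible {A B : Type*} [Fintype A] [Fintype B]
    (U : Matrix (A × B) (A × B) ℂ) (σ : Matrix B B ℂ) : Prop :=
  ∀ ρ : Matrix A A ℂ, IsState ρ → traceFst (Ad U (ρ ⊗ₖ σ)) = σ

/-- The map `ρ ↦ Tr_B [U (ρ ⊗ σ) U†]` on `A` that is implemented by `U` with the catalyst `σ`. -/
def implementedMap {A B : Type*} [Fintype A] [Fintype B]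
    (U : Matrix (A × B) (A × B) ℂ) (σ : Matrix B B ℂ) (ρ : Matrix A A ℂ) : Matrix A A ℂ :=
  traceSnd (Ad U (ρ ⊗ₖ σ))

/-- The use of `σ` by `U` is genuine: the implemented channel on `A` is not merely a unitary
channel, i.e. some randomness is extracted from `σ`. -/
def UtilizesInformation {A B : Type*} [Fintype A] [DecidableEq A] [Fintype B]
    (U : Matrix (A × B) (A × B) ℂ) (σ : Matrix B B ℂ) : Prop :=
  ¬ ∃ V ∈ Matrix.unitaryGroup A ℂ, ∀ ρ : Matrix A A ℂ, IsState ρ → implementedMap U σ ρ = Ad V ρ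

/-- `U₀ ⊗ U₁`, with `U₀` on `A₀ ⊗ B₀` and `U₁` on `A₁ ⊗ B₁`, as an operator on
`(A₀ ⊗ A₁) ⊗ (B₀ ⊗ B₁)`. -/
def delocalized {A₀ B₀ A₁ B₁ : Type*}
    (U₀ : Matrix (A₀ × B₀) (A₀ × B₀) ℂ) (U₁ : Matrix (A₁ × B₁) (A₁ × B₁) ℂ) :
    Matrix ((A₀ × A₁) × (B₀ × B₁)) ((A₀ × A₁) × (B₀ × B₁)) ℂ :=
  (U₀ ⊗ₖ U₁).submatrix (Equiv.prodProdProdComm A₀ A₁ B₀ B₁) (Equiv.prodProdProdComm A₀ A₁ B₀ B₁)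

/-- The pair `(U₀, U₁)` is compatible with the delocalized catalyst `σ` on `B₀ ⊗ B₁`: for every
input state of `A₀ ⊗ A₁`, the joint state `σ` is returned unchanged. -/
def IsPairCompatible {A₀ B₀ A₁ B₁ : Type*} [Fintype A₀] [Fintype B₀] [Fintype A₁] [Fintype B₁]
    (U₀ : Matrix (A₀ × B₀) (A₀ × B₀) ℂ) (U₁ : Matrix (A₁ × B₁) (A₁ × B₁) ℂ)
    (σ : Matrix (B₀ × B₁) (B₀ × B₁) ℂ) : Prop :=
  IsCompatible (delocalized U₀ U₁) σ

/-- The state `τ` on `B₀ ⊗ B₁` is an extension of `σ` on `B₀`. -/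
def IsExtension {B₀ B₁ : Type*} [Fintype B₀] [Fintype B₁]
    (σ : Matrix B₀ B₀ ℂ) (τ : Matrix (B₀ × B₁) (B₀ × B₁) ℂ) : Prop :=
  IsState τ ∧ traceSnd τ = σ

/-! The classical counterpart: an invertible interaction of the target system `X` and the
source `Y` is a permutation of `X × Y`, and states are probability vectors. -/

/-- The permutation `f` of `X × Y` is compatible with the distribution `p` of `Y`: for every
initial value `i` of `X`, the distribution of `Y` after the interaction is again `p`. -/
def IsClassicalCompatible {X Y : Type*} [Fintype Y] [DecidableEq Y]
    (f : Equiv.Perm (X × Y)) (p : Y → ℝ) : Prop :=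
  ∀ (i : X) (j : Y), ∑ j' with (f (i, j')).2 = j, p j' = p j

/-- The use of `p` by `f` is genuine: the map implemented on `X` is not merely a permutation. -/
def ClassicallyUtilizesInformation {X Y : Type*}
    (f : Equiv.Perm (X × Y)) (p : Y → ℝ) : Prop :=
  ¬ ∃ g : Equiv.Perm X, ∀ (i : X) (j : Y), p j ≠ 0 → (f (i, j)).1 = g i

/-- `f × id`, as a permutation of `X × (Y × Z)`. -/
def extendPerm {X Y : Type*} (Z : Type*) (f : Equiv.Perm (X × Y)) : Equiv.Perm (X × (Y × Z)) :=
  (Equiv.prodAssoc X Y Z).symm.trans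
    ((Equiv.prodCongr f (Equiv.refl Z)).trans (Equiv.prodAssoc X Y Z))

/-- The joint distribution `q` of `Y × Z` is an extension of the distribution `p` of `Y`. -/
def IsClassicalExtension {Y Z : Type*} [Fintype Y] [Fintype Z]
    (p : Y → ℝ) (q : Y × Z → ℝ) : Prop :=
  q ∈ stdSimplex ℝ (Y × Z) ∧ ∀ j, ∑ k, q (j, k) = p j

/-- The permutation only reads `Y`: it never changes its value. -/
def IsReading {X Y : Type*} (f : Equiv.Perm (X × Y)) : Prop :=
  ∀ (i : X) (j : Y), (f (i, j)).2 = j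

/-! Any purification `ψ` of the source detects a genuine use. If the pair returns the pure state
`ψ`, no correlation with it can survive: `(U₀ ⊗ U₁)(φ ⊗ ψ) = Wφ ⊗ ψ` with `W` unitary on `A₀ ⊗ A₁`
(`IsCompatible.exists_mul_appendVec`). In the Heisenberg picture an observable `X` of `A₀` does not
see `U₁`, so the dual `E` of the map implemented by `U₀` satisfies `E X ⊗ 1 = Wᴴ (X ⊗ 1) W`. The
right side is a unital star homomorphism in `X`, hence so is `E`, and star endomorphisms of a full
matrix algebra are conjugations by unitaries. The implemented channel is then unitary. Classically,
reading fixes every value of the source, hence every joint distribution, while a controlled swap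
still extracts randomness. -/

/-- Two operators with the same expectation in every state are equal. -/
theorem eq_of_forall_isState_trace_mul {A : Type*} [Fintype A] [DecidableEq A] {M N : Matrix A A ℂ}
    (h : ∀ ρ : Matrix A A ℂ, IsState ρ → (M * ρ).trace = (N * ρ).trace) : M = N := by
  have key : ∀ x : A → ℂ, star x ⬝ᵥ ((M - N) *ᵥ x) = 0 := by
    intro x
    by_cases hx : x = 0
    · simp [hx]
    have hc : 0 < star x ⬝ᵥ x := dotProduct_star_self_pos_iff.mpr hx
    have hs : IsState ((star x ⬝ᵥ x)⁻¹ • vecMulVec x (star x)) := by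
      refine ⟨(posSemidef_vecMulVec_self_star x).smul (inv_nonneg.mpr hc.le), ?_⟩
      rw [trace_smul, trace_vecMulVec, dotProduct_comm x, smul_eq_mul, inv_mul_cancel₀ hc.ne']
    have h1 := h _ hs
    simp only [Matrix.mul_smul, trace_smul, smul_eq_mul, mul_vecMulVec, trace_vecMulVec] at h1
    have h2 := mul_left_cancel₀ (inv_ne_zero hc.ne') h1
    rw [sub_mulVec, dotProduct_sub, dotProduct_comm, h2, dotProduct_comm, sub_self]
  -- Polarization over `ℂ`: an operator with zero quadratic form is zero.
  have hT : toEuclideanLin (M - N) = 0 := by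
    refine (inner_map_self_eq_zero _).mp fun x => ?_
    have h1 := key x.ofLp
    rw [EuclideanSpace.inner_eq_star_dotProduct, ← star_eq_zero, ← star_dotProduct_star,
      star_star, dotProduct_comm]
    exact h1
  exact sub_eq_zero.mp ((map_eq_zero_iff _ (toEuclideanLin (𝕜 := ℂ)).injective).mp hT)

/-- A star-endomorphism of a full matrix algebra is conjugation by a unitary. -/
theorem exists_unitary_of_starAlgHom {A : Type*} [Fintype A] [DecidableEq A]
    (E : Matrix A A ℂ →⋆ₐ[ℂ] Matrix A A ℂ) :
    ∃ V ∈ unitaryGroup A ℂ, ∀ X, E X = Vᴴ * X * V := by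
  rcases isEmpty_or_nonempty A with hA | hA
  · exact ⟨1, one_mem _, fun X => Subsingleton.elim _ _⟩
  -- A full matrix ring is simple, so `E` is injective; equal dimensions make it surjective.
  have hinj : Function.Injective E := (E : Matrix A A ℂ →+* Matrix A A ℂ).injective
  have hsurj : Function.Surjective E :=
    LinearMap.surjective_of_injective (f := E.toAlgHom.toLinearMap) hinj
  let e := StarAlgEquiv.ofBijective E ⟨hinj, hsurj⟩
  let t := toEuclideanCLM (n := A) (𝕜 := ℂ)
  let f := (t.symm.trans e).trans t
  -- Star automorphisms of the operators on a Hilbert space are inner.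
  obtain ⟨U, hU⟩ := f.eq_linearIsometryEquivConjStarAlgEquiv
    (LinearMap.continuous_of_finiteDimensional f.toAlgEquiv.toLinearMap)
  let u := Unitary.linearIsometryEquiv.symm U
  have hts : ∀ M, t (star M) = star (t M) := fun M => map_star t M
  have htinj : Function.Injective t := EquivLike.injective t
  obtain ⟨W, htW⟩ : ∃ W, t W = u := EquivLike.surjective t _
  have hW : W * Wᴴ = 1 := htinj <| by
    rw [← star_eq_conjTranspose, map_mul, hts, htW, map_one, Unitary.mul_star_self_of_mem u.2]
  refine ⟨Wᴴ, mem_unitaryGroup_iff'.mpr ?_, fun X => htinj ?_⟩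
  · rw [star_eq_conjTranspose, conjTranspose_conjTranspose, hW]
  have h1 : f (t X) = u * t X * star (u : EuclideanSpace ℂ A →L[ℂ] EuclideanSpace ℂ A) := by
    rw [hU, ← Unitary.conjStarAlgAut_symm_unitaryLinearIsometryEquiv, Unitary.conjStarAlgAut_apply]
  have h2 : f (t X) = t (E X) := congrArg (fun M => t (E M)) (t.symm_apply_apply X)
  rw [← h2, h1, conjTranspose_conjTranspose, map_mul, map_mul, ← star_eq_conjTranspose, hts, htW]

/-! ### Interaction with a pure catalyst -/

/-- The isometry `φ ↦ φ ⊗ ψ`. -/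
def appendVec (A : Type*) {B : Type*} [DecidableEq A] (ψ : B → ℂ) : Matrix (A × B) A ℂ :=
  Matrix.of fun x a => if x.1 = a then ψ x.2 else 0

section appendVec
variable {A B : Type*} [Fintype A] [DecidableEq A]

theorem appendVec_mul_mul_conjTranspose (ψ : B → ℂ) (ρ : Matrix A A ℂ) :
    appendVec A ψ * ρ * (appendVec A ψ)ᴴ = ρ ⊗ₖ vecMulVec ψ (star ψ) := by
  ext ⟨a, b⟩ ⟨a', b'⟩
  simp [mul_apply, appendVec, vecMulVec_apply, apply_ite]
  ring

theorem mul_appendVec_apply [Fintype B] {C : Type*} (M : Matrix C (A × B) ℂ) (ψ : B → ℂ)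
    (c : C) (a : A) :
    (M * appendVec A ψ) c a = ∑ b, M c (a, b) * ψ b := by
  simp [mul_apply, appendVec, Fintype.sum_prod_type_right]

theorem conjTranspose_appendVec_mul_mul_apply [Fintype B] (M : Matrix (A × B) (A × B) ℂ) (ψ : B → ℂ)
    (a a' : A) :
    ((appendVec A ψ)ᴴ * M * appendVec A ψ) a a' =
      ∑ b, ∑ b', star (ψ b') * M (a, b') (a', b) * ψ b := by
  rw [mul_appendVec_apply]
  refine Finset.sum_congr rfl fun b _ => ?_
  simp [mul_apply, appendVec, Fintype.sum_prod_type_right, Finset.sum_mul, apply_ite]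

/-- `Y ⊗ 1` sends `φ ⊗ ψ` to `Yφ ⊗ ψ`, and `ψ` is normalized. -/
theorem conjTranspose_appendVec_mul_kronecker_one_mul [Fintype B] [DecidableEq B] {ψ : B → ℂ}
    (hψ : star ψ ⬝ᵥ ψ = 1) (Y : Matrix A A ℂ) :
    (appendVec A ψ)ᴴ * (Y ⊗ₖ (1 : Matrix B B ℂ)) * appendVec A ψ = Y := by
  ext a a'
  rw [conjTranspose_appendVec_mul_mul_apply]
  simp only [kroneckerMap_apply, one_apply, mul_ite, mul_one, mul_zero, ite_mul, zero_mul,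
    Finset.sum_ite_eq', Finset.mem_univ, if_true]
  calc ∑ b, star (ψ b) * Y a a' * ψ b = (star ψ ⬝ᵥ ψ) * Y a a' := by
        rw [dotProduct, Finset.sum_mul]
        exact Finset.sum_congr rfl fun b _ => by simp only [Pi.star_apply]; ring
    _ = Y a a' := by rw [hψ, one_mul]

/-- An interaction that returns a pure catalyst does not correlate it with the system. -/
theorem IsCompatible.exists_mul_appendVec [Fintype B] [DecidableEq B]
    {U : Matrix (A × B) (A × B) ℂ} {ψ : B → ℂ}
    (hψ : star ψ ⬝ᵥ ψ = 1) (h : IsCompatible U (vecMulVec ψ (star ψ))) :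
    ∃ W ∈ unitaryGroup A ℂ,
      U * appendVec A ψ = (W ⊗ₖ (1 : Matrix B B ℂ)) * appendVec A ψ := by
  let K : B → Matrix A A ℂ := fun b => (U * appendVec A ψ).submatrix (fun a => (a, b)) id
  have hψ' : ∑ b, star (ψ b) * ψ b = 1 := hψ
  -- The `K b` are the Kraus blocks `⟨b|U|· ⊗ ψ⟩`; compatibility fixes the expectation of `(K b')ᴴ *
  -- K b` in every state.
  have hK : ∀ b b', (K b')ᴴ * K b = (ψ b * star (ψ b')) • (1 : Matrix A A ℂ) := by
    intro b b'
    refine eq_of_forall_isState_trace_mul fun ρ hρ => ?_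
    have h1 := congrFun (congrFun (h ρ hρ) b) b'
    have h2 : Ad U (ρ ⊗ₖ vecMulVec ψ (star ψ)) =
        (U * appendVec A ψ) * ρ * (U * appendVec A ψ)ᴴ := by
      simp only [Ad, ← appendVec_mul_mul_conjTranspose, conjTranspose_mul, Matrix.mul_assoc]
    rw [h2] at h1
    rw [Matrix.smul_mul, Matrix.one_mul, trace_smul, hρ.2, smul_eq_mul, mul_one, Matrix.mul_assoc,
      trace_mul_comm]
    exact h1
  -- Contraction with `ψ` is forced: it recovers `W` from `K b = ψ b • W`.
  let W : Matrix A A ℂ := ∑ b, star (ψ b) • K b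
  have hWK : ∀ b, Wᴴ * K b = ψ b • (1 : Matrix A A ℂ) := by
    intro b
    simp only [W, conjTranspose_sum, conjTranspose_smul, star_star, Finset.sum_mul, Matrix.smul_mul, hK,
      smul_smul]
    rw [← Finset.sum_smul]
    congr 1
    calc _ = ψ b * ∑ b', star (ψ b') * ψ b' := by
          rw [Finset.mul_sum]; exact Finset.sum_congr rfl fun _ _ => by ring
      _ = ψ b := by rw [hψ', mul_one]
  have hWW : Wᴴ * W = 1 := by
    calc Wᴴ * W = ∑ b, star (ψ b) • (Wᴴ * K b) := by
          conv_lhs => arg 2; rw [show W = ∑ b, star (ψ b) • K b from rfl]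
          simp only [Finset.mul_sum, Matrix.mul_smul]
      _ = 1 := by simp only [hWK, smul_smul, ← Finset.sum_smul, hψ', one_smul]
  have hKW : ∀ b, K b = ψ b • W := by
    intro b
    have h1 : (K b)ᴴ * W = star (ψ b) • (1 : Matrix A A ℂ) := by
      simpa using congrArg conjTranspose (hWK b)
    -- With `D = K b - ψ b • W`, the four terms of `Dᴴ * D` are `± |ψ b|²` and cancel.
    rw [← sub_eq_zero, ← conjTranspose_mul_self_eq_zero]
    simp only [conjTranspose_sub, conjTranspose_smul, Matrix.sub_mul, Matrix.mul_sub, hK,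
      Matrix.smul_mul, Matrix.mul_smul, h1, hWK, hWW, smul_smul, mul_comm (star (ψ b)), sub_self,
      smul_zero]
  refine ⟨W, mem_unitaryGroup_iff'.mpr hWW, ?_⟩
  ext ⟨a, b⟩ a'
  have h1 := congrFun (congrFun (hKW b) a) a'
  rw [mul_appendVec_apply (W ⊗ₖ 1)]
  simpa [K, kroneckerMap_apply, one_apply, mul_comm] using h1

end appendVec

/-! ### Algebra of delocalized interactions -/

section delocalized
variable {A₀ B₀ A₁ B₁ : Type*}

theorem delocalized_mul [Fintype A₀] [Fintype B₀] [Fintype A₁] [Fintype B₁]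
    (M N : Matrix (A₀ × B₀) (A₀ × B₀) ℂ)
    (M' N' : Matrix (A₁ × B₁) (A₁ × B₁) ℂ) :
    delocalized M M' * delocalized N N' = delocalized (M * N) (M' * N') := by
  rw [delocalized, delocalized, submatrix_mul_equiv, ← mul_kronecker_mul, delocalized]

theorem conjTranspose_delocalized (M : Matrix (A₀ × B₀) (A₀ × B₀) ℂ)
    (M' : Matrix (A₁ × B₁) (A₁ × B₁) ℂ) :
    (delocalized M M')ᴴ = delocalized Mᴴ M'ᴴ := by
  rw [delocalized, conjTranspose_submatrix, conjTranspose_kronecker, delocalized]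

theorem delocalized_kronecker (M : Matrix A₀ A₀ ℂ) (N : Matrix B₀ B₀ ℂ) (M' : Matrix A₁ A₁ ℂ)
    (N' : Matrix B₁ B₁ ℂ) :
    delocalized (M ⊗ₖ N) (M' ⊗ₖ N') = (M ⊗ₖ M') ⊗ₖ (N ⊗ₖ N') := by
  ext ⟨⟨a, a'⟩, b, b'⟩ ⟨⟨c, c'⟩, d, d'⟩
  simp [delocalized]
  ring

end delocalized

/-! ### Heisenberg picture and unitarity of the implemented map -/

/-- The dual (Heisenberg picture) of the map implemented by `U` with the catalyst `σ`. -/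
def implementedDual {A B : Type*} [Fintype A] [Fintype B] [DecidableEq B]
    (U : Matrix (A × B) (A × B) ℂ) (σ : Matrix B B ℂ) (X : Matrix A A ℂ) : Matrix A A ℂ :=
  Matrix.of fun a a' =>
    ∑ b, ∑ b', σ b b' * (Uᴴ * (X ⊗ₖ (1 : Matrix B B ℂ)) * U) (a, b') (a', b)

theorem trace_mul_implementedMap {A B : Type*} [Fintype A] [Fintype B] [DecidableEq B]
    (U : Matrix (A × B) (A × B) ℂ) (σ : Matrix B B ℂ) (X ρ : Matrix A A ℂ) :
    (X * implementedMap U σ ρ).trace = (implementedDual U σ X * ρ).trace := by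
  have h1 : ∀ M : Matrix (A × B) (A × B) ℂ,
      (X * traceSnd M).trace = ((X ⊗ₖ (1 : Matrix B B ℂ)) * M).trace := by
    intro M
    simp only [trace, diag, mul_apply, traceSnd, of_apply, Fintype.sum_prod_type, kroneckerMap_apply,
      one_apply, mul_ite, mul_one, mul_zero, ite_mul, zero_mul, Finset.sum_ite_eq, Finset.mem_univ,
      if_true, Finset.mul_sum]
    exact Finset.sum_congr rfl fun _ _ => Finset.sum_comm
  rw [implementedMap, h1, Ad, ← Matrix.mul_assoc, trace_mul_comm,
    ← Matrix.mul_assoc, ← Matrix.mul_assoc]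
  simp only [implementedDual]
  generalize Uᴴ * (X ⊗ₖ (1 : Matrix B B ℂ)) * U = N
  simp only [trace, diag, mul_apply, of_apply, Fintype.sum_prod_type, kroneckerMap_apply,
    Finset.sum_mul]
  refine Finset.sum_congr rfl fun a _ => ?_
  rw [Finset.sum_comm]
  refine Finset.sum_congr rfl fun a' _ => ?_
  rw [Finset.sum_comm]
  exact Finset.sum_congr rfl fun b _ => Finset.sum_congr rfl fun b' _ => by ring

/-- An observable trivial on `A₁ ⊗ B₁` sees `ψ` only through its reduced state on `B₀`; this is how
`implementedDual` arises from the purification. -/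
theorem conjTranspose_appendVec_mul_delocalized_one_mul {A₀ B₀ A₁ B₁ : Type*} [Fintype A₀]
    [Fintype B₀] [Fintype A₁] [Fintype B₁] [DecidableEq A₀] [DecidableEq A₁] [DecidableEq B₁]
    (M : Matrix (A₀ × B₀) (A₀ × B₀) ℂ) (ψ : B₀ × B₁ → ℂ) :
    (appendVec (A₀ × A₁) ψ)ᴴ * delocalized M (1 : Matrix (A₁ × B₁) (A₁ × B₁) ℂ) *
        appendVec (A₀ × A₁) ψ =
      (Matrix.of fun a a' => ∑ b, ∑ b', traceSnd (vecMulVec ψ (star ψ)) b b' * M (a, b') (a', b)) ⊗ₖ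
        (1 : Matrix A₁ A₁ ℂ) := by
  ext ⟨a, c⟩ ⟨a', c'⟩
  rw [conjTranspose_appendVec_mul_mul_apply]
  by_cases hc : c = c'
  · subst hc
    simp [delocalized, Fintype.sum_prod_type, one_apply, traceSnd, vecMulVec_apply, Finset.sum_mul]
    refine Finset.sum_congr rfl fun b _ => ?_
    rw [Finset.sum_comm]
    exact Finset.sum_congr rfl fun b' _ => Finset.sum_congr rfl fun d _ => by ring
  · simp [delocalized, one_apply, hc]

/-- If a pure extension of the catalyst is returned unchanged, whatever happens on the other side,
then the implemented map is unitary. -/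
theorem IsPairCompatible.not_utilizesInformation {A₀ B₀ A₁ B₁ : Type*} [Fintype A₀] [DecidableEq A₀]
    [Fintype B₀] [DecidableEq B₀] [Fintype A₁] [DecidableEq A₁] [Nonempty A₁] [Fintype B₁]
    [DecidableEq B₁] {U₀ : Matrix (A₀ × B₀) (A₀ × B₀) ℂ} {U₁ : Matrix (A₁ × B₁) (A₁ × B₁) ℂ}
    {ψ : B₀ × B₁ → ℂ} (hψ : star ψ ⬝ᵥ ψ = 1) (hU₁ : U₁ ∈ unitaryGroup (A₁ × B₁) ℂ)
    (h : IsPairCompatible U₀ U₁ (vecMulVec ψ (star ψ))) :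
    ¬ UtilizesInformation U₀ (traceSnd (vecMulVec ψ (star ψ))) := by
  obtain ⟨W, hW, hUW⟩ := IsCompatible.exists_mul_appendVec hψ h
  have hW1 : Wᴴ * W = 1 := mem_unitaryGroup_iff'.mp hW
  have hW2 : W * Wᴴ = 1 := mem_unitaryGroup_iff.mp hW
  set σ := traceSnd (vecMulVec ψ (star ψ))
  have key : ∀ X, implementedDual U₀ σ X ⊗ₖ (1 : Matrix A₁ A₁ ℂ) =
      Wᴴ * (X ⊗ₖ (1 : Matrix A₁ A₁ ℂ)) * W := by
    intro X
    have hU₁' : U₁ᴴ * U₁ = 1 := mem_unitaryGroup_iff'.mp hU₁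
    let P := appendVec (A₀ × A₁) ψ
    let D := delocalized U₀ U₁
    let Y : Matrix (A₀ × A₁) (A₀ × A₁) ℂ := X ⊗ₖ (1 : Matrix A₁ A₁ ℂ)
    calc _ = Pᴴ * delocalized (U₀ᴴ * (X ⊗ₖ (1 : Matrix B₀ B₀ ℂ)) * U₀)
          (1 : Matrix (A₁ × B₁) (A₁ × B₁) ℂ) * P :=
          (conjTranspose_appendVec_mul_delocalized_one_mul _ ψ).symm
      _ = (D * P)ᴴ * (Y ⊗ₖ (1 : Matrix (B₀ × B₁) (B₀ × B₁) ℂ)) * (D * P) := by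
          have h1 : Y ⊗ₖ (1 : Matrix (B₀ × B₁) (B₀ × B₁) ℂ) =
              delocalized (X ⊗ₖ (1 : Matrix B₀ B₀ ℂ)) (1 : Matrix (A₁ × B₁) (A₁ × B₁) ℂ) := by
            rw [← one_kronecker_one, ← one_kronecker_one, delocalized_kronecker]
          -- `U₁` drops out here, through `U₁ᴴ * U₁ = 1`.
          have h2 : Dᴴ * (Y ⊗ₖ (1 : Matrix (B₀ × B₁) (B₀ × B₁) ℂ)) * D =
              delocalized (U₀ᴴ * (X ⊗ₖ (1 : Matrix B₀ B₀ ℂ)) * U₀) 1 := by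
            rw [h1, conjTranspose_delocalized, delocalized_mul, delocalized_mul, Matrix.mul_one,
              hU₁']
          rw [← h2, conjTranspose_mul]
          simp only [Matrix.mul_assoc]
      _ = Pᴴ * ((Wᴴ * Y * W) ⊗ₖ (1 : Matrix (B₀ × B₁) (B₀ × B₁) ℂ)) * P := by
          have h3 : (Wᴴ * Y * W) ⊗ₖ (1 : Matrix (B₀ × B₁) (B₀ × B₁) ℂ) =
              (W ⊗ₖ (1 : Matrix (B₀ × B₁) (B₀ × B₁) ℂ))ᴴ *
                (Y ⊗ₖ (1 : Matrix (B₀ × B₁) (B₀ × B₁) ℂ)) *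
                (W ⊗ₖ (1 : Matrix (B₀ × B₁) (B₀ × B₁) ℂ)) := by
            rw [conjTranspose_kronecker, ← mul_kronecker_mul, ← mul_kronecker_mul,
              conjTranspose_one, Matrix.one_mul, Matrix.one_mul]
          rw [show D * P = _ from hUW, h3, conjTranspose_mul]
          simp only [P, Matrix.mul_assoc]
      _ = _ := conjTranspose_appendVec_mul_kronecker_one_mul hψ _
  have cancel : ∀ {M N : Matrix A₀ A₀ ℂ},
      M ⊗ₖ (1 : Matrix A₁ A₁ ℂ) = N ⊗ₖ (1 : Matrix A₁ A₁ ℂ) → M = N := by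
    intro M N hMN
    obtain ⟨c⟩ := ‹Nonempty A₁›
    ext a a'
    simpa using congrFun (congrFun hMN (a, c)) (a', c)
  -- Each law is inherited from conjugation by `W` after tensoring with `1`; multiplicativity needs
  -- `W * Wᴴ = 1`.
  let E : Matrix A₀ A₀ ℂ →⋆ₐ[ℂ] Matrix A₀ A₀ ℂ :=
    { toFun := implementedDual U₀ σ
      map_one' := cancel <| by rw [key, one_kronecker_one, Matrix.mul_one, hW1]
      map_mul' := fun X Y => cancel <| by
        rw [key, ← Matrix.mul_one (1 : Matrix A₁ A₁ ℂ), mul_kronecker_mul, mul_kronecker_mul,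
          key, key]
        simp only [Matrix.mul_assoc]
        rw [← Matrix.mul_assoc W, hW2, Matrix.one_mul]
      map_zero' := cancel <| by simp [key]
      map_add' := fun X Y => cancel <| by
        simp only [key, add_kronecker, Matrix.mul_add, Matrix.add_mul]
      commutes' := fun r => cancel <| by
        simp only [key, Algebra.algebraMap_eq_smul_one, smul_kronecker, one_kronecker_one,
          Matrix.mul_smul, Matrix.smul_mul, Matrix.mul_one, hW1]
      map_star' := fun X => cancel <| by
        simp only [star_eq_conjTranspose]
        rw [key, ← conjTranspose_one (n := A₁), ← conjTranspose_kronecker,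
          ← conjTranspose_kronecker, key]
        simp only [conjTranspose_mul, conjTranspose_conjTranspose, Matrix.mul_assoc] }
  obtain ⟨V, hV, hE⟩ := exists_unitary_of_starAlgHom E
  refine not_not.mpr ⟨V, hV, fun ρ _ => ext_iff_trace_mul_left.mpr fun X => ?_⟩
  rw [trace_mul_implementedMap, show implementedDual U₀ σ X = _ from hE X, Ad, Matrix.mul_assoc,
    Matrix.mul_assoc, trace_mul_comm]
  simp only [Matrix.mul_assoc]

theorem mainTheorem5 :
    -- every genuine use of quantum information is detected by some purification of the source
    (∀ {A₀ : Type u} {B₀ : Type v} [Fintype A₀] [DecidableEq A₀] [Fintype B₀] [DecidableEq B₀]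
      (U₀ : Matrix (A₀ × B₀) (A₀ × B₀) ℂ) (σ : Matrix B₀ B₀ ℂ),
      U₀ ∈ Matrix.unitaryGroup (A₀ × B₀) ℂ → IsState σ →
      IsCompatible U₀ σ → UtilizesInformation U₀ σ →
      ∃ (B₁ : Type v) (_ : Fintype B₁) (_ : DecidableEq B₁)
        (τ : Matrix (B₀ × B₁) (B₀ × B₁) ℂ),
        IsExtension σ τ ∧ IsPureState τ ∧
        ∀ {A₁ : Type w} [Fintype A₁] [DecidableEq A₁] [Nonempty A₁],
          ∀ U₁ ∈ Matrix.unitaryGroup (A₁ × B₁) ℂ, ¬ IsPairCompatible U₀ U₁ τ) ∧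
    -- classically, reading is compatible with every extension of the source
    (∀ {X : Type u} {Y : Type v} {Z : Type w} [Fintype X] [DecidableEq X]
      [Fintype Y] [DecidableEq Y] [Fintype Z] [DecidableEq Z]
      (f : Equiv.Perm (X × Y)) (p : Y → ℝ) (q : Y × Z → ℝ),
      IsReading f → p ∈ stdSimplex ℝ Y → IsClassicalExtension p q →
      IsClassicalCompatible (extendPerm Z f) q) ∧
    -- and reading is a genuine use of every source that is not deterministic
    (∀ {X : Type u} {Y : Type v} [Fintype X] [DecidableEq X] [Nontrivial X]
      [Fintype Y] [DecidableEq Y] (p : Y → ℝ),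
      p ∈ stdSimplex ℝ Y → (∃ j j', j ≠ j' ∧ p j ≠ 0 ∧ p j' ≠ 0) →
      ∃ f : Equiv.Perm (X × Y), IsReading f ∧ ClassicallyUtilizesInformation f p) := by
  refine ⟨?_, ?_, ?_⟩
  · intro A₀ B₀ _ _ _ _ U₀ σ _ hσ _ hU
    obtain ⟨S, hS⟩ : ∃ S : Matrix B₀ B₀ ℂ, σ = Sᴴ * S := by
      open scoped MatrixOrder in
      exact CStarAlgebra.nonneg_iff_eq_star_mul_self.mp hσ.1.nonneg
    -- The purification is `S` read as a vector, conjugated so that tracing out the second index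
    -- gives `Sᴴ * S`.
    let ψ : B₀ × B₀ → ℂ := fun x => star (S x.2 x.1)
    have htr : traceSnd (vecMulVec ψ (star ψ)) = σ := by
      ext j j'
      simp [hS, traceSnd, vecMulVec_apply, mul_apply, ψ]
    have hψ : star ψ ⬝ᵥ ψ = 1 := by
      rw [← hσ.2, ← htr, dotProduct_comm]
      simp [trace, traceSnd, vecMulVec_apply, dotProduct, Fintype.sum_prod_type]
    have hst : IsState (vecMulVec ψ (star ψ)) :=
      ⟨posSemidef_vecMulVec_self_star ψ, by rw [trace_vecMulVec, dotProduct_comm, hψ]⟩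
    refine ⟨B₀, inferInstance, inferInstance, vecMulVec ψ (star ψ), ⟨hst, htr⟩, ⟨hst, ψ, rfl⟩, ?_⟩
    intro A₁ _ _ _ U₁ hU₁ h
    exact h.not_utilizesInformation hψ hU₁ (htr.symm ▸ hU)
  · intro X Y Z _ _ _ _ _ _ f p q hf _ _ i j
    have h1 : ∀ j', (extendPerm Z f (i, j')).2 = j' := by
      rintro ⟨y, z⟩
      exact Prod.ext (hf i y) rfl
    simp [h1, Finset.filter_eq']
  · rintro X Y _ _ _ _ _ p _ ⟨j, j', hne, hj, hj'⟩
    obtain ⟨a, b, hab⟩ := exists_pair_ne X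
    -- A swap controlled by `j`: `a` goes to `b` if `j` is read and stays `a` if `j'` is read, so no
    -- single `g` fits both.
    let f : Equiv.Perm (X × Y) :=
      ((Equiv.prodComm X Y).trans (Equiv.prodShear (Equiv.refl Y)
        fun y => if y = j then Equiv.swap a b else Equiv.refl X)).trans (Equiv.prodComm Y X)
    refine ⟨f, fun i y => rfl, ?_⟩
    rintro ⟨g, hg⟩
    have h1 := hg a j hj
    have h2 := hg a j' hj'
    simp [f, hne.symm] at h1 h2
    exact hab (h2.trans h1.symm)
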